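/- Let $A$ be a $2\times 2$ integer matrix all of whose (complex) eigenvalues have modulus strictly bigger than $1$, and let $f:\mathbb{T}^2\to\mathbb{T}^2$, $f(x+\mathbb{Z}^2)=Ax+\mathbb{Z}^2$, be the induced expanding toral endomorphism of $\mathbb{T}^2=\mathbb{R}^2/\mathbb{Z}^2$. Let $\mathcal{M}=\{R_1,\dots,R_n\}$ be a Markov partition for $f$, that is, a finite cover of $\mathbb{T}^2$ by nonempty sets $R_i=\overline{\operatorname{int}(R_i)}$ with pairwise disjoint interiors such that 1. for every sequence $(x_k)_{k\ge 0}$ in $\{1,\dots,n\}$ the set $\bigcap_{k=0}^\infty f^{-k}(\operatorname{int}(R_{x_k}))$ has at most one point; 2. whenever $f(\operatorname{int}(R_i))\cap\operatorname{int}(R_j)\neq\emptyset$, each $y\in\operatorname{int}(R_j)$ has a unique preimage under $f$ in $R_i$. Put $\partial\mathcal{M}=\bigcup_{i=1}^n\partial R_i$. Then $f(\partial\mathcal{M})\subset\partial\mathcal{M}$, and the restriction of $f$ to $\partial\mathcal{M}$ has positive topological entropy: $h(f|_{\partial\mathcal{M}})>0$. In fact, if $\rho$ is any metric on $\mathbb{T}^2$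 inducing the standard topology, and $\varepsilon>0$, $\lambda>1$ are such that $\rho(x,y)<\varepsilon$ implies $\rho(f(x),f(y))\ge\lambda\,\rho(x,y)$ for all $x,y\in\mathbb{T}^2$, then $h(f|_{\partial\mathcal{M}})\ge\log\lambda$. -/

import Mathlib

/-- The projection `ℝ^d → 𝕋^d = ℝ^d / ℤ^d`, where `𝕋^d` is realised as `(ℝ / ℤ)^d`. -/
def torusProj {d : ℕ} (x : Fin d → ℝ) : UnitAddTorus (Fin d) :=
  fun i => ((x i : ℝ) : UnitAddCircle)

/-- The endomorphism `f_A` of `𝕋^d` induced by an integer matrix `A`, that is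
`f_A (x + ℤ^d) = A x + ℤ^d`; see `toralEndomorphism_torusProj`. -/
def toralEndomorphism {d : ℕ} (A : Matrix (Fin d) (Fin d) ℤ) :
    UnitAddTorus (Fin d) → UnitAddTorus (Fin d) :=
  fun x i => ∑ j, A i j • x j

theorem toralEndomorphism_torusProj {d : ℕ} (A : Matrix (Fin d) (Fin d) ℤ) (x : Fin d → ℝ) :
    toralEndomorphism A (torusProj x) =
      torusProj (Matrix.mulVec (A.map (fun k : ℤ => (k : ℝ))) x) := by
  funext i
  have h : ((∑ j, A i j • x j : ℝ) : UnitAddCircle) = ∑ j, A i j • ((x j : ℝ) : UnitAddCircle) := by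
    simp
  simp only [toralEndomorphism, torusProj, Matrix.mulVec, dotProduct, Matrix.map_apply]
  rw [← h]
  simp [zsmul_eq_mul]

theorem torusProj_surjective {d : ℕ} : Function.Surjective (torusProj (d := d)) := by
  intro y
  choose x hx using fun i => QuotientAddGroup.mk_surjective (y i)
  exact ⟨x, funext hx⟩

/-- An integer matrix is expanding if all its (complex) eigenvalues have modulus `> 1`. -/
def Matrix.IsExpanding {d : ℕ} (A : Matrix (Fin d) (Fin d) ℤ) : Prop :=
  ∀ z : ℂ, Module.End.HasEigenvalue (Matrix.toLin' (A.map (fun k : ℤ => (k : ℂ)))) z → 1 < ‖z‖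

/-- `R` is proper if it is nonempty and the closure of its interior. -/
def IsProperSet {X : Type*} [TopologicalSpace X] (R : Set X) : Prop :=
  R = closure (interior R) ∧ R.Nonempty

/-- The finite family `R` is a Markov partition for `f : X → X`. -/
structure IsMarkovPartition {X : Type*} [TopologicalSpace X] (f : X → X) {n : ℕ}
    (R : Fin n → Set X) : Prop where
  cover : ⋃ i, R i = Set.univ
  proper : ∀ i, IsProperSet (R i)
  disjoint_interior : ∀ i j, i ≠ j → Disjoint (interior (R i)) (interior (R j))
  /-- The partition is metrically generating. -/
  generating : ∀ s : ℕ → Fin n, (⋂ k : ℕ, f^[k] ⁻¹' interior (R (s k))).Subsingleton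
  /-- The Markov property. -/
  markov : ∀ i j, (f '' interior (R i) ∩ interior (R j)).Nonempty →
    ∀ y ∈ interior (R j), ∃! x, x ∈ R i ∧ f x = y

/-- The boundary of a partition: the union of the boundaries of its members. -/
def partitionBoundary {X : Type*} [TopologicalSpace X] {n : ℕ} (R : Fin n → Set X) : Set X :=
  ⋃ i, frontier (R i)

/-- `X` carries an adapted metric for `f` with expansion constant `lam > 1`: a metric `m` inducing
the given topology `t` of `X` such that, for some `ε > 0`, `f` expands `m`-distances smaller than
`ε` by a factor of at least `lam`. -/
def IsExpansionConstant {X : Type*} [t : TopologicalSpace X] (f : X → X) (lam : ℝ) : Prop :=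
  1 < lam ∧ ∃ m : MetricSpace X, m.toPseudoMetricSpace.toUniformSpace.toTopologicalSpace = t ∧
    ∃ ε : ℝ, 0 < ε ∧ ∀ x y : X, m.dist x y < ε → lam * m.dist x y ≤ m.dist (f x) (f y)

/-- A function expanding small distances expands the distance of two points along orbits which
stay close. -/
theorem pow_mul_dist_le_dist_iterate {X : Type*} [MetricSpace X] {f : X → X} {lam ε : ℝ}
    (hlam : 0 ≤ lam)
    (hexp : ∀ x y, dist x y < ε → lam * dist x y ≤ dist (f x) (f y)) {x y : X} :
    ∀ n : ℕ, (∀ k < n, dist (f^[k] x) (f^[k] y) < ε) →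
      lam ^ n * dist x y ≤ dist (f^[n] x) (f^[n] y)
  | 0, _ => by simp
  | n + 1, h => by
    have ih := pow_mul_dist_le_dist_iterate hlam hexp n fun k hk => h k (by omega)
    calc lam ^ (n + 1) * dist x y = lam * (lam ^ n * dist x y) := by ring
      _ ≤ lam * dist (f^[n] x) (f^[n] y) := by gcongr
      _ ≤ dist (f (f^[n] x)) (f (f^[n] y)) := hexp _ _ (h n (by omega))
      _ = _ := by rw [Function.iterate_succ_apply', Function.iterate_succ_apply']

/-- The distance of two points of a connected set covered by finitely many sets of diameter at
most `r`. -/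
theorem IsPreconnected.dist_le_card_mul {X ι : Type*} [MetricSpace X] {C : Set X}
    (hC : IsPreconnected C) {s : Finset ι} {B : ι → Set X} {r : ℝ} (hr : 0 ≤ r)
    (hcov : ∀ z ∈ C, ∃ i ∈ s, z ∈ B i)
    (hB : ∀ i ∈ s, ∀ z ∈ B i, ∀ w ∈ B i, dist z w ≤ r) {a b : X} (ha : a ∈ C) (hb : b ∈ C) :
    dist a b ≤ s.card * r := by
  have hI : Set.Icc 0 (dist a b) ⊆ ⋃ i ∈ s, dist a '' B i := by
    intro t ht
    have h1 : IsPreconnected (dist a '' C) :=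
      hC.image _ (continuous_const.dist continuous_id).continuousOn
    have h2 := h1.Icc_subset ⟨a, ha, dist_self a⟩ ⟨b, hb, rfl⟩ ht
    obtain ⟨z, hz, rfl⟩ := h2
    obtain ⟨i, hi, hzi⟩ := hcov z hz
    exact Set.mem_biUnion hi ⟨z, hzi, rfl⟩
  have hvol : ENNReal.ofReal (dist a b) ≤ ENNReal.ofReal (s.card * r) := by
    calc ENNReal.ofReal (dist a b) = MeasureTheory.volume (Set.Icc 0 (dist a b)) := by simp
      _ ≤ MeasureTheory.volume (⋃ i ∈ s, dist a '' B i) := MeasureTheory.measure_mono hI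
      _ ≤ ∑ i ∈ s, MeasureTheory.volume (dist a '' B i) :=
        MeasureTheory.measure_biUnion_finset_le _ _
      _ ≤ ∑ i ∈ s, ENNReal.ofReal r := by
        refine Finset.sum_le_sum fun i hi => (Real.volume_le_diam _).trans ?_
        refine Metric.ediam_le ?_
        rintro _ ⟨z, hz, rfl⟩ _ ⟨w, hw, rfl⟩
        rw [edist_dist]
        refine ENNReal.ofReal_le_ofReal ((?_ : dist (dist a z) (dist a w) ≤ dist z w).trans
          (hB i hi z hz w hw))
        rw [Real.dist_eq]
        simpa [dist_comm] using abs_dist_sub_le z w a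
      _ = ENNReal.ofReal (s.card * r) := by
        rw [Finset.sum_const, nsmul_eq_mul, ENNReal.ofReal_mul (by positivity),
          ENNReal.ofReal_natCast]
  exact (ENNReal.ofReal_le_ofReal_iff (by positivity)).1 hvol

open Dynamics in
/-- The entropy of a locally expanding map on a set containing a nondegenerate connected set is at
least the logarithm of the expansion constant. -/
theorem log_le_coverEntropy_of_expanding {X : Type*} [MetricSpace X] {f : X → X} {lam ε : ℝ}
    (hlam : 1 < lam) (hε : 0 < ε)
    (hexp : ∀ x y, dist x y < ε → lam * dist x y ≤ dist (f x) (f y)) {F C : Set X}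
    (hC : IsPreconnected C) (hCF : C ⊆ F) (hnt : C.Nontrivial) :
    (Real.log lam : EReal) ≤ coverEntropy f F := by
  have hlam0 : 0 < lam := one_pos.trans hlam
  obtain ⟨a, ha, b, hb, hab⟩ := hnt
  have hδ : 0 < dist a b := dist_pos.2 hab
  let V : SetRel X X := {p | dist p.1 p.2 < ε / 2}
  have hV : V ∈ uniformity X := Metric.dist_mem_uniformity (half_pos hε)
  refine le_trans ?_ (coverEntropyEntourage_le_coverEntropy f F hV)
  rw [← ENNReal.log_ofReal_of_pos hlam0, ← ExpGrowth.expGrowthSup_pow, coverEntropyEntourage]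
  refine ExpGrowth.expGrowthSup_of_eventually_ge (b := ENNReal.ofReal (dist a b / (lam * ε)))
    (by simpa using by positivity) ?_
  filter_upwards [Filter.eventually_ge_atTop 1] with n hn
  obtain ⟨m, rfl⟩ : ∃ m, n = m + 1 := ⟨n - 1, by omega⟩
  rcases eq_or_ne (coverMincard f F V (m + 1)) ⊤ with htop | htop
  · simp [htop]
  obtain ⟨s, hs, hcard⟩ := (coverMincard_finite_iff f F V (m + 1)).1 htop.lt_top
  have key : dist a b ≤ s.card * (ε / lam ^ m) := by
    refine hC.dist_le_card_mul (s := s) (B := fun x => {y | (y, x) ∈ dynEntourage f V (m + 1)})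
      (by positivity) (fun z hz => ?_) (fun x _ z hz w hw => ?_) ha hb
    · obtain ⟨x, hx, hzx⟩ := hs (hCF hz)
      exact ⟨x, hx, hzx⟩
    · have hclose : ∀ k < m + 1, dist (f^[k] z) (f^[k] w) < ε := fun k hk => by
        have h1 : dist (f^[k] z) (f^[k] x) < ε / 2 := mem_dynEntourage.1 hz k hk
        have h2 : dist (f^[k] w) (f^[k] x) < ε / 2 := mem_dynEntourage.1 hw k hk
        linarith [dist_triangle_right (f^[k] z) (f^[k] w) (f^[k] x)]
      rw [le_div_iff₀ (by positivity), mul_comm]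
      exact (pow_mul_dist_le_dist_iterate hlam0.le hexp m fun k hk => hclose k (by omega)).trans
        (hclose m (by omega)).le
  rw [← hcard, ← ENNReal.ofReal_pow hlam0.le, ← ENNReal.ofReal_mul (by positivity)]
  simp only [ENat.toENNReal_coe]
  rw [← ENNReal.ofReal_natCast]
  refine ENNReal.ofReal_le_ofReal ?_
  rw [mul_div_assoc', le_div_iff₀ (by positivity)] at key
  rw [div_mul_eq_mul_div, div_le_iff₀ (by positivity), pow_succ]
  nlinarith

/-- Nowhere vanishing functions on the plane have continuous logarithms. -/
theorem Complex.exists_continuous_log {F : ℂ → ℂ} (hF : Continuous F) (h0 : ∀ z, F z ≠ 0) :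
    ∃ L : ℂ → ℂ, Continuous L ∧ ∀ z, Complex.exp (L z) = F z := by
  obtain ⟨L, ⟨-, hL⟩, -⟩ := Complex.isCoveringMapOn_exp.existsUnique_continuousMap_lifts
    ⟨F, hF⟩ (a₀ := 0) (e₀ := Complex.log (F 0)) (Complex.exp_log (h0 0)) h0
  exact ⟨L, L.continuous, fun z => congrFun hL z⟩

/-- Nowhere vanishing functions on a compact totally disconnected space have continuous
logarithms. -/
theorem Complex.exists_continuous_log_of_totallyDisconnectedSpace {X : Type*} [TopologicalSpace X]
    [CompactSpace X] [T2Space X] [TotallyDisconnectedSpace X] {F : X → ℂ} (hF : Continuous F)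
    (h0 : ∀ z, F z ≠ 0) : ∃ L : X → ℂ, Continuous L ∧ ∀ z, Complex.exp (L z) = F z := by
  let f : C(X, {z : ℂ // z ≠ 0}) := ⟨fun x => ⟨F x, h0 x⟩, by fun_prop⟩
  let S : Set ({z : ℂ // z ≠ 0} × {z : ℂ // z ≠ 0}) := {q | (q.1 / q.2 : ℂ) ∈ Complex.slitPlane}
  have hS : IsOpen S := by
    refine Complex.isOpen_slitPlane.preimage (Continuous.div ?_ ?_ fun q => q.2.2) <;> fun_prop
  obtain ⟨n, g, h, hg⟩ := f.exists_finite_approximation_of_mem_nhds_diagonal (S := S)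
    (hS.mem_nhdsSet.2 fun q hq => by
      have : q.1 = q.2 := hq
      simp [S, this, div_self q.2.2])
  have hhg : Continuous fun x => (h (g x) : ℂ) := (continuous_of_discreteTopology
    (f := fun i : Fin n => (h i : ℂ))).comp hg.1
  have hlog : Continuous fun x => Complex.log (h (g x)) := (continuous_of_discreteTopology
    (f := fun i : Fin n => Complex.log (h i))).comp hg.1
  refine ⟨fun x => Complex.log (F x / h (g x)) + Complex.log (h (g x)),
    ((hF.div hhg fun x => (h (g x)).2).clog hg.2).add hlog, fun x => ?_⟩
  rw [Complex.exp_add, Complex.exp_log (div_ne_zero (h0 x) (h (g x)).2),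
    Complex.exp_log (h (g x)).2, div_mul_cancel₀ _ (h (g x)).2]

/-- The identity of a circle around the origin has no continuous logarithm. -/
theorem Complex.not_exists_continuous_log_circle {L : ℂ → ℂ} (hL : Continuous L) (p : ℂ) {r : ℝ}
    (hr : 0 < r) (h : ∀ z, ‖z - p‖ = r → Complex.exp (L z) = z - p) : False := by
  let γ : ℝ → ℂ := fun t => p + r * Complex.exp (t * Complex.I)
  have hγ : ∀ t, γ t - p = r * Complex.exp (t * Complex.I) := fun t => by simp [γ]
  let c : ℝ → ℂ := fun t => L (γ t) - t * Complex.I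
  have hc : Continuous c := by fun_prop
  have hexp : ∀ t, Complex.exp (c t) = r := fun t => by
    rw [Complex.exp_sub, h _ (by rw [hγ]; simp [Complex.norm_exp_ofReal_mul_I, hr.le]), hγ]
    field_simp
  have hconst : c 0 = c (2 * Real.pi) := by
    refine Complex.isCoveringMap_exp.const_of_comp hc (fun t t' => ?_) _ _
    simp [hexp]
  have hγeq : γ 0 = γ (2 * Real.pi) := by simp [γ]
  have : (2 * Real.pi : ℂ) * Complex.I = 0 := by
    have h3 := hconst
    simp only [c, hγeq] at h3
    push_cast at h3
    linear_combination h3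
  simp [Real.pi_ne_zero] at this

theorem eq_of_mem_ray_of_mem_sphere {E : Type*} [NormedAddCommGroup E] [NormedSpace ℝ E]
    {x p q : E} {r t : ℝ} (hp : ‖p - x‖ < r) (hq : ‖q - x‖ = r) (ht : 0 ≤ t)
    (h : ‖p + t • (q - p) - x‖ = r) : t = 1 := by
  rcases lt_trichotomy t 1 with h1 | h1 | h1
  · have : p + t • (q - p) - x = (1 - t) • (p - x) + t • (q - x) := by module
    have h2 := norm_add_le ((1 - t) • (p - x)) (t • (q - x))
    rw [← this, h, norm_smul, norm_smul, hq, Real.norm_of_nonneg ht,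
      Real.norm_of_nonneg (by linarith)] at h2
    nlinarith
  · exact h1
  · have : t • (q - x) = (p + t • (q - p) - x) + (t - 1) • (p - x) := by module
    have h2 := norm_add_le (p + t • (q - p) - x) ((t - 1) • (p - x))
    rw [← this, h, norm_smul, norm_smul, hq, Real.norm_of_nonneg ht,
      Real.norm_of_nonneg (by linarith)] at h2
    nlinarith

/-- A point of a disc and a point of its boundary circle are not separated in the closed disc by a
totally disconnected set. -/
theorem Complex.not_isTotallyDisconnected_of_separates {U V K : Set ℂ} {x p q : ℂ} {r : ℝ}
    (hU : IsOpen U) (hV : IsOpen V) (hK : IsClosed K) (hUV : Disjoint U V) (hUK : Disjoint U K)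
    (hcov : Metric.closedBall x r ⊆ U ∪ V ∪ K) (hp : p ∈ U) (hpr : ‖p - x‖ < r) (hq : q ∈ V)
    (hqr : ‖q - x‖ = r) : ¬ IsTotallyDisconnected (K ∩ Metric.closedBall x r) := by
  intro htd
  have hr : 0 < r := (norm_nonneg _).trans_lt hpr
  have hpq : p ≠ q := fun h => Set.disjoint_left.1 hUV hp (h ▸ hq)
  set K' := K ∩ Metric.closedBall x r with hK'
  have hK'c : IsCompact K' := (isCompact_closedBall x r).inter_left hK
  set J := Metric.sphere x r \ V with hJ
  have hJc : IsClosed J := Metric.isClosed_sphere.sdiff hV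
  have hpJ : p ∉ J := fun h => by
    have : ‖p - x‖ = r := by simpa [dist_eq_norm] using h.1
    linarith
  have hpK : p ∉ K' := fun h => Set.disjoint_left.1 hUK hp h.1
  set S := {z : ℂ | (z - p) / (p - q) ∈ Complex.slitPlane} with hS
  have hSo : IsOpen S := Complex.isOpen_slitPlane.preimage (by fun_prop)
  have hJS : J ⊆ S := by
    intro z hz
    by_contra hzS
    simp only [hS, Set.mem_ofPred_eq, Complex.mem_slitPlane_iff_not_le_zero, not_not] at hzS
    obtain ⟨hre, him⟩ := Complex.le_def.1 hzS
    set w := (z - p) / (p - q) with hw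
    have hz' : z = p + (-w.re) • (q - p) := by
      have h1 : (w.re : ℂ) = w := Complex.ext rfl (by simpa using him.symm)
      have h2 : w * (p - q) = z - p := div_mul_cancel₀ _ (sub_ne_zero.2 hpq)
      rw [Complex.real_smul, Complex.ofReal_neg, h1]
      linear_combination -h2
    have h1 := eq_of_mem_ray_of_mem_sphere hpr hqr (t := -w.re) (by simpa using hre)
      (by rw [← hz']; simpa [dist_eq_norm] using hz.1)
    rw [h1, one_smul, add_sub_cancel] at hz'
    exact hz.2 (hz' ▸ hq)
  -- a logarithm of `z - p` on `K' ∪ J`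
  obtain ⟨L, hLc, hL⟩ : ∃ L : ℂ → ℂ, ContinuousOn L (K' ∪ J) ∧
      ∀ z ∈ K' ∪ J, Complex.exp (L z) = z - p := by
    have : CompactSpace K' := isCompact_iff_compactSpace.1 hK'c
    have : TotallyDisconnectedSpace K' := totallyDisconnectedSpace_subtype_iff.2 htd
    obtain ⟨L₁, hL₁c, hL₁⟩ := Complex.exists_continuous_log_of_totallyDisconnectedSpace
      (F := fun z : K' => (z : ℂ) - p) (by fun_prop)
      (fun z hz => hpK (by rw [← sub_eq_zero.1 hz]; exact z.2))
    obtain ⟨C, hC, hSC, hCJ⟩ := exists_clopen_of_closed_subset_open (X := K')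
      (Z := Subtype.val ⁻¹' Sᶜ) (U := Subtype.val ⁻¹' Jᶜ)
      (hSo.isClosed_compl.preimage continuous_subtype_val)
      (hJc.isOpen_compl.preimage continuous_subtype_val)
      (Set.preimage_mono (Set.compl_subset_compl.2 hJS))
    have hC' : IsClosed (Subtype.val '' C : Set ℂ) :=
      hK'c.isClosed.isClosedEmbedding_subtypeVal.isClosedMap _ hC.isClosed
    have hD : IsClosed (Subtype.val '' Cᶜ ∪ J : Set ℂ) :=
      (hK'c.isClosed.isClosedEmbedding_subtypeVal.isClosedMap _ hC.compl.isClosed).union hJc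
    have hDS : (Subtype.val '' Cᶜ ∪ J : Set ℂ) ⊆ S := by
      rintro _ (⟨z, hz, rfl⟩ | hz)
      · by_contra h
        exact hz (hSC h)
      · exact hJS hz
    have hdisj : ∀ z ∈ (Subtype.val '' Cᶜ ∪ J : Set ℂ), z ∉ (Subtype.val '' C : Set ℂ) := by
      rintro _ (⟨z, hz, rfl⟩ | hz) ⟨w, hw, hwz⟩
      · exact hz (Subtype.ext hwz ▸ hw)
      · exact hCJ hw (hwz ▸ hz)
    have hE : K' ∪ J = Subtype.val '' C ∪ (Subtype.val '' Cᶜ ∪ J) := by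
      rw [← Set.union_assoc, ← Set.image_union, Set.union_compl_self, Set.image_univ,
        Subtype.range_coe]
    obtain ⟨L₂, hL₂⟩ : ∃ L₂ : ℂ → ℂ, ∀ z : K', L₂ z = L₁ z :=
      ⟨Function.extend Subtype.val L₁ 0, fun z => Subtype.val_injective.extend_apply _ _ _⟩
    have hL₂c : ContinuousOn L₂ K' := by
      rw [continuousOn_iff_continuous_domRestrict]
      exact hL₁c.congr fun z => (hL₂ z).symm
    classical
    refine ⟨(Subtype.val '' C : Set ℂ).piecewise L₂
      (fun z => Complex.log ((z - p) / (p - q)) + Complex.log (p - q)), ?_, ?_⟩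
    · rw [hE]
      refine ContinuousOn.union_of_isClosed ?_ ?_ hC' hD
      · refine (hL₂c.mono ?_).congr fun z hz => Set.piecewise_eq_of_mem _ _ _ hz
        rintro _ ⟨z, -, rfl⟩
        exact z.2
      · refine ContinuousOn.congr ?_ fun z hz => Set.piecewise_eq_of_notMem _ _ _ (hdisj z hz)
        exact (ContinuousOn.clog (by fun_prop) fun z hz => hDS hz).add continuousOn_const
    · intro z hz
      rw [hE] at hz
      by_cases hzC : z ∈ (Subtype.val '' C : Set ℂ)
      · rw [Set.piecewise_eq_of_mem _ _ _ hzC]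
        obtain ⟨z, -, rfl⟩ := hzC
        rw [hL₂, hL₁]
      · have hzD := hz.resolve_left hzC
        have hzp : z - p ≠ 0 := fun h => by
          have := hDS hzD
          simp [hS, h] at this
        rw [Set.piecewise_eq_of_notMem _ _ _ hzC, Complex.exp_add,
          Complex.exp_log (div_ne_zero hzp (sub_ne_zero.2 hpq)),
          Complex.exp_log (sub_ne_zero.2 hpq), div_mul_cancel₀ _ (sub_ne_zero.2 hpq)]
  obtain ⟨G, hGc, hG⟩ : ∃ G : ℂ → ℂ, Continuous G ∧ ∀ z ∈ K' ∪ J, G z = L z := by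
    obtain ⟨G, hG⟩ := ContinuousMap.exists_restrict_eq (hK'c.isClosed.union hJc)
      (⟨(K' ∪ J).domRestrict L, hLc.domRestrict⟩ : C(↥(K' ∪ J), ℂ))
    exact ⟨G, G.continuous, fun z hz => congrArg (fun g => g ⟨z, hz⟩) hG⟩
  classical
  set W := U ∩ Metric.ball x r with hW
  have hfr : frontier W ⊆ K' ∪ J := by
    intro z hz
    rw [(hU.inter Metric.isOpen_ball).frontier_eq] at hz
    have hzU : z ∈ closure U := closure_mono Set.inter_subset_left hz.1
    have hzB : z ∈ Metric.closedBall x r :=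
      Metric.closure_ball_subset_closedBall (closure_mono Set.inter_subset_right hz.1)
    have hzV : z ∉ V := fun h => Set.disjoint_left.1 (hUV.closure_left hV) hzU h
    by_cases hzs : z ∈ Metric.sphere x r
    · exact Or.inr ⟨hzs, hzV⟩
    · have hzb : z ∈ Metric.ball x r := by
        rw [Metric.mem_closedBall] at hzB
        exact lt_of_le_of_ne hzB hzs
      rcases hcov hzB with (h | h) | h
      · exact absurd ⟨h, hzb⟩ hz.2
      · exact absurd h hzV
      · exact Or.inl ⟨h, hzB⟩
  obtain ⟨Λ, hΛc, hΛ⟩ := Complex.exists_continuous_log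
    (F := W.piecewise (fun z => Complex.exp (G z)) (fun z => z - p))
    (by
      refine continuous_piecewise (fun z hz => ?_) (by fun_prop) (by fun_prop)
      rw [hG z (hfr hz), hL z (hfr hz)])
    (fun z => by
      by_cases hz : z ∈ W
      · simp [hz, Complex.exp_ne_zero]
      · rw [Set.piecewise_eq_of_notMem _ _ _ hz]
        exact fun h => hz (by rw [sub_eq_zero.1 h]; exact ⟨hp, by simpa [dist_eq_norm] using hpr⟩))
  refine Complex.not_exists_continuous_log_circle hΛc p (r := 2 * r) (by linarith) fun z hz => ?_
  rw [hΛ, Set.piecewise_eq_of_notMem]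
  intro hzW
  have h1 : ‖z - x‖ < r := by simpa [dist_eq_norm] using hzW.2
  have h2 := norm_sub_le_norm_sub_add_norm_sub z x p
  rw [norm_sub_rev x p] at h2
  linarith

open Matrix in
attribute [local instance] Matrix.linftyOpNormedRing Matrix.linftyOpNormedAlgebra in
/-- Some power of an expanding matrix expands the sup norm. -/
theorem Matrix.IsExpanding.exists_pow_expands {d : ℕ} {A : Matrix (Fin d) (Fin d) ℤ}
    (hA : A.IsExpanding) : ∃ k : ℕ, 0 < k ∧ ∃ c : ℝ, 1 < c ∧ ∀ v : Fin d → ℝ,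
      c * ‖v‖ ≤ ‖A.map (fun k : ℤ => (k : ℝ)) ^ k *ᵥ v‖ := by
  rcases isEmpty_or_nonempty (Fin d) with hd | hd
  · exact ⟨1, one_pos, 2, one_lt_two, fun v => by simp [Subsingleton.elim v 0]⟩
  set M := A.map (fun k : ℤ => (k : ℂ)) with hM
  have hspec : ∀ z ∈ spectrum ℂ M, 1 < ‖z‖ := fun z hz => by
    refine hA z (Module.End.hasEigenvalue_iff_mem_spectrum.2 ?_)
    rwa [Matrix.spectrum_toLin']
  have hunit : IsUnit M := by
    by_contra h
    have := hspec 0 (spectrum.zero_mem_iff ℂ |>.2 h)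
    rw [norm_zero] at this
    linarith
  obtain ⟨u, hu⟩ := hunit
  set B : Matrix (Fin d) (Fin d) ℂ := ↑u⁻¹ with hB
  have hrad : spectralRadius ℂ B < 1 := by
    refine spectrum.spectralRadius_lt_of_forall_lt (r := 1) B fun z hz => ?_
    have h1 := hspec z⁻¹ (hu ▸ spectrum.inv₀_mem_iff.2 hz)
    rw [norm_inv] at h1
    exact_mod_cast (one_lt_inv_iff₀.1 h1).2
  have hlim := (spectrum.pow_nnnorm_pow_one_div_tendsto_nhds_spectralRadius B).eventually_lt_const
    hrad
  obtain ⟨k, hk, hk0⟩ := (hlim.and (Filter.eventually_gt_atTop 0)).exists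
  have hBk : ‖B ^ k‖ < 1 := by
    by_contra! h
    refine hk.not_ge (ENNReal.one_le_rpow ?_ (by positivity))
    exact_mod_cast h
  obtain ⟨η, hη, hη1⟩ := exists_between hBk
  have hη0 : 0 < η := (norm_nonneg _).trans_lt hη
  refine ⟨k, hk0, η⁻¹, (one_lt_inv₀ hη0).2 hη1, fun v => ?_⟩
  have hnorm : ∀ w : Fin d → ℝ, ‖fun i => (w i : ℂ)‖ = ‖w‖ := fun w => by
    simp [Pi.norm_def]
  have hmap : M ^ k *ᵥ (fun i => (v i : ℂ)) =
      fun i => ((A.map (fun k : ℤ => (k : ℝ)) ^ k *ᵥ v) i : ℂ) := by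
    have h1 : M = (A.map (fun k : ℤ => (k : ℝ))).map (algebraMap ℝ ℂ) := by
      ext i j; simp [M]
    rw [h1, ← Matrix.map_pow]
    funext i
    exact (RingHom.map_mulVec (algebraMap ℝ ℂ) (A.map (fun k : ℤ => (k : ℝ)) ^ k) v i).symm
  have hBM : B ^ k *ᵥ (M ^ k *ᵥ (fun i => (v i : ℂ))) = fun i => (v i : ℂ) := by
    rw [Matrix.mulVec_mulVec, ← hu, hB, ← Units.val_pow_eq_pow_val, ← Units.val_pow_eq_pow_val,
      ← Units.val_mul, inv_pow, inv_mul_cancel, Units.val_one, Matrix.one_mulVec]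
  rw [inv_mul_le_iff₀ hη0]
  calc ‖v‖ = ‖B ^ k *ᵥ (M ^ k *ᵥ (fun i => (v i : ℂ)))‖ := by rw [hBM, hnorm]
    _ ≤ ‖B ^ k‖ * ‖M ^ k *ᵥ (fun i => (v i : ℂ))‖ := Matrix.linfty_opNorm_mulVec _ _
    _ ≤ η * ‖A.map (fun k : ℤ => (k : ℝ)) ^ k *ᵥ v‖ := by
      rw [hmap, hnorm]
      gcongr

theorem continuous_torusProj {d : ℕ} : Continuous (torusProj (d := d)) :=
  continuous_pi fun i => (AddCircle.continuous_mk' 1).comp (continuous_apply i)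

theorem norm_torusProj {d : ℕ} {v : Fin d → ℝ} (hv : ‖v‖ ≤ 1 / 2) : ‖torusProj v‖ = ‖v‖ := by
  have h : ∀ i, ‖torusProj v i‖₊ = ‖v i‖₊ := fun i => by
    rw [← NNReal.coe_inj, coe_nnnorm, coe_nnnorm, Real.norm_eq_abs]
    refine (AddCircle.norm_coe_eq_abs_iff 1 one_ne_zero).2 ?_
    rw [abs_one]
    exact (norm_le_pi_norm v i).trans hv
  simp [Pi.norm_def, h]

theorem exists_torusProj_eq_of_norm {d : ℕ} (x : UnitAddTorus (Fin d)) :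
    ∃ v : Fin d → ℝ, torusProj v = x ∧ ‖v‖ = ‖x‖ := by
  have h : ∀ i, ∃ t : ℝ, (t : UnitAddCircle) = x i ∧ |t| ≤ 1 / 2 := fun i => by
    obtain ⟨s, hs⟩ := QuotientAddGroup.mk_surjective (x i)
    refine ⟨s - round s, ?_, abs_sub_round s⟩
    rw [← hs, sub_eq_add_neg, ← Int.cast_neg]
    simp
  choose v hv hv' using h
  refine ⟨v, funext hv, ?_⟩
  rw [← norm_torusProj ((pi_norm_le_iff_of_nonneg (by norm_num)).2 hv')]
  exact congrArg norm (funext hv)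

theorem continuous_toralEndomorphism {d : ℕ} (A : Matrix (Fin d) (Fin d) ℤ) :
    Continuous (toralEndomorphism A) := by
  unfold toralEndomorphism
  fun_prop

theorem toralEndomorphism_iterate_sub {d : ℕ} (A : Matrix (Fin d) (Fin d) ℤ)
    (x y : UnitAddTorus (Fin d)) (k : ℕ) : (toralEndomorphism A)^[k] (x - y) =
      (toralEndomorphism A)^[k] x - (toralEndomorphism A)^[k] y := by
  induction k with
  | zero => rfl
  | succ k ih =>
    simp only [Function.iterate_succ_apply', ih]
    funext i
    simp [toralEndomorphism, smul_sub]

open Matrix in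
theorem toralEndomorphism_iterate_torusProj {d : ℕ} (A : Matrix (Fin d) (Fin d) ℤ)
    (v : Fin d → ℝ) (k : ℕ) : (toralEndomorphism A)^[k] (torusProj v) =
      torusProj (A.map (fun k : ℤ => (k : ℝ)) ^ k *ᵥ v) := by
  induction k with
  | zero => simp
  | succ k ih =>
    rw [Function.iterate_succ_apply', ih, toralEndomorphism_torusProj, Matrix.mulVec_mulVec,
      pow_succ']

/-- Some iterate of an expanding toral endomorphism expands small distances. -/
theorem Matrix.IsExpanding.exists_iterate_expands {d : ℕ} {A : Matrix (Fin d) (Fin d) ℤ}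
    (hA : A.IsExpanding) : ∃ k : ℕ, 0 < k ∧ ∃ c : ℝ, 1 < c ∧ ∃ ε : ℝ, 0 < ε ∧
      ∀ x y : UnitAddTorus (Fin d), dist x y < ε →
        c * dist x y ≤ dist ((toralEndomorphism A)^[k] x) ((toralEndomorphism A)^[k] y) := by
  obtain ⟨k, hk, c, hc, h⟩ := hA.exists_pow_expands
  have hcont : Continuous fun v : Fin d → ℝ => ‖(A.map (fun k : ℤ => (k : ℝ)) ^ k).mulVec v‖ :=
    (Continuous.matrix_mulVec continuous_const continuous_id).norm
  obtain ⟨ε, hε, hball⟩ := Metric.eventually_nhds_iff.1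
    ((hcont.tendsto 0).eventually_lt_const (by simp : _ < (1 / 2 : ℝ)))
  refine ⟨k, hk, c, hc, ε, hε, fun x y hxy => ?_⟩
  obtain ⟨v, hv, hvn⟩ := exists_torusProj_eq_of_norm (x - y)
  rw [dist_eq_norm, dist_eq_norm, ← toralEndomorphism_iterate_sub, ← hvn, ← hv,
    toralEndomorphism_iterate_torusProj, norm_torusProj]
  · exact h v
  · refine (hball ?_).le
    rwa [dist_zero_right, hvn, ← dist_eq_norm]

/-- A continuous map, some iterate of which expands small distances, has an adapted metric. -/
theorem exists_isExpansionConstant_of_iterate {X : Type*} [MetricSpace X] {f : X → X}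
    (hf : Continuous f) {k : ℕ} (hk : 0 < k) {c ε : ℝ} (hc : 1 < c) (hε : 0 < ε)
    (hexp : ∀ x y, dist x y < ε → c * dist x y ≤ dist (f^[k] x) (f^[k] y)) :
    ∃ lam, IsExpansionConstant f lam := by
  obtain ⟨lam, hlam, hlamk⟩ : ∃ lam : ℝ, 1 < lam ∧ lam ^ k = c :=
    ⟨c ^ (k : ℝ)⁻¹, Real.one_lt_rpow hc (by positivity),
      Real.rpow_inv_natCast_pow (by linarith) hk.ne'⟩
  have hlam0 : 0 < lam := by linarith
  let b : ℕ → X → X → ℝ := fun i x y => (lam ^ i)⁻¹ * dist (f^[i] x) (f^[i] y)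
  have hb : ∀ i x y, 0 ≤ b i x y := fun i x y => by positivity
  let D : X → X → ℝ := fun x y => ∑ i ∈ Finset.range k, b i x y
  have hD : ∀ x y, dist x y ≤ D x y := fun x y => by
    have := Finset.single_le_sum (f := fun i => b i x y) (fun i _ => hb i x y)
      (Finset.mem_range.2 hk)
    simpa [b] using this
  have hDcont : ∀ x, Continuous (D x) := fun x => by
    refine continuous_finsetSum _ fun i _ => ?_
    exact continuous_const.mul (continuous_const.dist (hf.iterate i))
  have hself : ∀ x, D x x = 0 := fun x => by simp [D, b]
  let m : MetricSpace X := MetricSpace.ofDistTopology D hself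
    (fun x y => by simp only [D, b, dist_comm])
    (fun x y z => by
      simp only [D, ← Finset.sum_add_distrib, b, ← mul_add]
      gcongr
      exact dist_triangle _ _ _)
    (fun s => by
      constructor
      · intro hs x hx
        obtain ⟨δ, hδ, h⟩ := Metric.isOpen_iff.1 hs x hx
        exact ⟨δ, hδ, fun y hy => h (by
          rw [Metric.mem_ball, dist_comm]
          exact (hD x y).trans_lt hy)⟩
      · intro h
        refine isOpen_iff_mem_nhds.2 fun x hx => ?_
        obtain ⟨δ, hδ, h⟩ := h x hx
        have : {y | D x y < δ} ∈ nhds x :=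
          (isOpen_lt (hDcont x) continuous_const).mem_nhds (by simpa [hself] using hδ)
        exact Filter.mem_of_superset this h)
    (fun x y h => dist_le_zero.1 (h ▸ hD x y))
  refine ⟨lam, hlam, m, rfl, ε, hε, fun x y (hxy : D x y < ε) => ?_⟩
  change lam * D x y ≤ D (f x) (f y)
  replace hxy := (hD x y).trans_lt hxy
  have hshift : D (f x) (f y) = lam * ∑ i ∈ Finset.range k, b (i + 1) x y := by
    rw [Finset.mul_sum]
    refine Finset.sum_congr rfl fun i _ => ?_
    simp only [b, Function.iterate_succ_apply]
    field_simp
    ring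
  have hends : b 0 x y ≤ b k x y := by
    have := hexp x y hxy
    simp only [b, hlamk, pow_zero, inv_one, one_mul, Function.iterate_zero, id]
    rwa [le_inv_mul_iff₀ (by linarith)]
  rw [hshift]
  refine mul_le_mul_of_nonneg_left ?_ hlam0.le
  have h1 := Finset.sum_range_succ (fun i => b i x y) k
  have h2 := Finset.sum_range_succ' (fun i => b i x y) k
  simp only [D]
  linarith

theorem Matrix.IsExpanding.exists_isExpansionConstant {d : ℕ} {A : Matrix (Fin d) (Fin d) ℤ}
    (hA : A.IsExpanding) : ∃ lam, IsExpansionConstant (toralEndomorphism A) lam := by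
  obtain ⟨k, hk, c, hc, ε, hε, h⟩ := hA.exists_iterate_expands
  exact exists_isExpansionConstant_of_iterate (continuous_toralEndomorphism A) hk hc hε h

theorem IsExpansionConstant.exists_injOn_nhds {X : Type*} [t : TopologicalSpace X] {f : X → X}
    {lam : ℝ} (h : IsExpansionConstant f lam) (x : X) : ∃ N ∈ nhds x, Set.InjOn f N := by
  obtain ⟨hlam, m, rfl, ε, hε, hexp⟩ := h
  refine ⟨Metric.ball x (ε / 2), Metric.ball_mem_nhds x (half_pos hε), fun y hy z hz hyz => ?_⟩
  have h1 : dist y z < ε := by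
    rw [Metric.mem_ball] at hy hz
    linarith [dist_triangle_right y z x]
  have h2 : lam * dist y z ≤ dist (f y) (f z) := hexp y z h1
  rw [hyz, dist_self] at h2
  exact dist_le_zero.1 (by nlinarith [dist_nonneg (x := y) (y := z)])

theorem IsExpansionConstant.log_le_coverEntropy {X : Type*} [u : UniformSpace X] [CompactSpace X]
    {f : X → X} {lam : ℝ} (h : IsExpansionConstant f lam) {F C : Set X}
    (hC : IsPreconnected C) (hCF : C ⊆ F) (hnt : C.Nontrivial) :
    (Real.log lam : EReal) ≤ Dynamics.coverEntropy f F := by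
  obtain ⟨hlam, m, ht, ε, hε, hexp⟩ := h
  obtain rfl := unique_uniformity_of_compact ht rfl
  exact log_le_coverEntropy_of_expanding hlam hε hexp hC hCF hnt

theorem IsProperSet.isClosed {X : Type*} [TopologicalSpace X] {R : Set X} (h : IsProperSet R) :
    IsClosed R := by
  rw [h.1]
  exact isClosed_closure

theorem IsProperSet.interior_nonempty {X : Type*} [TopologicalSpace X] {R : Set X}
    (h : IsProperSet R) : (interior R).Nonempty :=
  closure_nonempty_iff.1 (h.1 ▸ h.2)

namespace IsMarkovPartition

variable {X : Type*} [TopologicalSpace X] {f : X → X} {n : ℕ} {R : Fin n → Set X}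

theorem exists_mem_interior (hR : IsMarkovPartition f R) {x : X} (hx : x ∉ partitionBoundary R) :
    ∃ i, x ∈ interior (R i) := by
  obtain ⟨i, hi⟩ := Set.mem_iUnion.1 (hR.cover.symm ▸ Set.mem_univ x)
  refine ⟨i, by_contra fun h => hx (Set.mem_iUnion.2 ⟨i, ?_⟩)⟩
  rw [(hR.proper i).isClosed.frontier_eq]
  exact ⟨hi, h⟩

theorem disjoint_interior_boundary (hR : IsMarkovPartition f R) (i : Fin n) :
    Disjoint (interior (R i)) (partitionBoundary R) := by
  refine Set.disjoint_iUnion_right.2 fun j => ?_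
  rcases eq_or_ne i j with rfl | hij
  · exact disjoint_interior_frontier
  · refine Disjoint.mono_right frontier_subset_closure ?_
    rw [(hR.proper j).isClosed.closure_eq, (hR.proper j).1]
    exact (hR.disjoint_interior i j hij).closure_right isOpen_interior

/-- The boundary of a Markov partition of a locally injective map is invariant. -/
theorem mapsTo_boundary [CompactSpace X] [T2Space X] (hR : IsMarkovPartition f R)
    (hf : Continuous f) (hinj : ∀ x, ∃ N ∈ nhds x, Set.InjOn f N) :
    Set.MapsTo f (partitionBoundary R) (partitionBoundary R) := by
  intro x hx
  by_contra hfx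
  obtain ⟨j, hj⟩ := hR.exists_mem_interior hfx
  obtain ⟨i, hi⟩ := Set.mem_iUnion.1 hx
  have hxR : x ∈ R i := (hR.proper i).isClosed.frontier_subset hi
  obtain ⟨N, hN, hNinj⟩ := hinj x
  have hj' : f ⁻¹' interior (R j) ∈ nhds x := hf.continuousAt (isOpen_interior.mem_nhds hj)
  have hne : (f '' interior (R i) ∩ interior (R j)).Nonempty := by
    have hx' : x ∈ closure (interior (R i)) := (hR.proper i).1 ▸ hxR
    obtain ⟨z, hz, hzi⟩ := mem_closure_iff_nhds.1 hx' _ hj'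
    exact ⟨f z, ⟨z, hzi, rfl⟩, hz⟩
  have huniq := hR.markov i j hne
  have hfar : IsClosed (f '' (R i \ interior N)) :=
    (((hR.proper i).isClosed.sdiff isOpen_interior).isCompact.image hf).isClosed
  have hxfar : f x ∉ f '' (R i \ interior N) := by
    rintro ⟨w, ⟨hw, hwN⟩, hwx⟩
    exact hwN ((huniq _ hj).unique ⟨hw, hwx⟩ ⟨hxR, rfl⟩ ▸ mem_interior_iff_mem_nhds.2 hN)
  have hmem : R i ∈ nhds x := by
    filter_upwards [hj', hN, hf.continuousAt (hfar.isOpen_compl.mem_nhds hxfar)] with z hz hzN hzf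
    obtain ⟨w, ⟨hw, hwz⟩, -⟩ := huniq _ hz
    have hwN : w ∈ N := interior_subset (by_contra fun h => hzf ⟨w, ⟨hw, h⟩, hwz⟩)
    exact hNinj hwN hzN hwz ▸ hw
  exact hi.2 (mem_interior_iff_mem_nhds.2 hmem)

theorem exists_ne [Nontrivial X] (hR : IsMarkovPartition f R) : ∃ i j : Fin n, i ≠ j := by
  obtain ⟨x, y, hxy⟩ := exists_pair_ne X
  obtain ⟨i, -⟩ := Set.mem_iUnion.1 (hR.cover.symm ▸ Set.mem_univ x)
  by_contra! h
  have hi : R i = Set.univ := by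
    rw [← hR.cover]
    exact Set.Subset.antisymm (Set.subset_iUnion R i)
      (Set.iUnion_subset fun j => h i j ▸ Set.Subset.rfl)
  exact hxy (hR.generating (fun _ => i) (by simp [hi]) (by simp [hi]))

end IsMarkovPartition

/-- The universal covering of the two-dimensional torus by the complex plane. -/
noncomputable def torusCover (z : ℂ) : UnitAddTorus (Fin 2) := torusProj ![z.re, z.im]

theorem continuous_torusCover : Continuous torusCover := by
  refine continuous_torusProj.comp (continuous_pi fun i => ?_)
  fin_cases i
  · exact Complex.continuous_re
  · exact Complex.continuous_im

theorem torusCover_surjective : Function.Surjective torusCover := fun x => by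
  obtain ⟨v, rfl⟩ := torusProj_surjective x
  refine ⟨⟨v 0, v 1⟩, congrArg torusProj ?_⟩
  ext i
  fin_cases i <;> rfl

theorem injOn_torusCover (x : ℂ) : Set.InjOn torusCover (Metric.ball x (1 / 4)) := by
  intro z hz w hw h
  have hzw : ‖z - w‖ ≤ 1 / 2 := by
    rw [Metric.mem_ball] at hz hw
    rw [← dist_eq_norm]
    linarith [dist_triangle_right z w x]
  have h0 : torusProj ![(z - w).re, (z - w).im] = 0 := by
    have : torusProj ![(z - w).re, (z - w).im] = torusCover z - torusCover w := by
      funext i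
      fin_cases i <;> simp [torusProj, torusCover]
    rw [this, h, sub_self]
  have hn := norm_torusProj (v := ![(z - w).re, (z - w).im]) (by
    refine (pi_norm_le_iff_of_nonneg (by norm_num)).2 fun i => ?_
    fin_cases i
    · exact (Complex.abs_re_le_norm _).trans hzw
    · exact (Complex.abs_im_le_norm _).trans hzw)
  rw [h0, norm_zero, eq_comm, norm_eq_zero] at hn
  have h1 := congrFun hn 0
  have h2 := congrFun hn 1
  exact sub_eq_zero.1 (Complex.ext h1 h2)

/-- A totally disconnected set does not separate the two-dimensional torus. -/
theorem not_isTotallyDisconnected_of_separates_torus {U V K : Set (UnitAddTorus (Fin 2))}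
    (hU : IsOpen U) (hV : IsOpen V) (hK : IsClosed K) (hUV : Disjoint U V) (hUK : Disjoint U K)
    (hcov : U ∪ V ∪ K = Set.univ) (hUne : U.Nonempty) (hVne : V.Nonempty) :
    ¬ IsTotallyDisconnected K := by
  intro htd
  have htd' : ∀ x : ℂ, ∀ t ⊆ torusCover ⁻¹' K ∩ Metric.ball x (1 / 4), IsPreconnected t →
      t.Subsingleton := fun x t ht hpre z hz w hw => by
    refine injOn_torusCover x (ht hz).2 (ht hw).2 ?_
    refine htd (torusCover '' t) ?_ (hpre.image _ continuous_torusCover.continuousOn)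
      ⟨z, hz, rfl⟩ ⟨w, hw, rfl⟩
    rintro _ ⟨y, hy, rfl⟩
    exact (ht hy).1
  set U' := torusCover ⁻¹' U with hU'
  set V' := torusCover ⁻¹' V with hV'
  have hUo : IsOpen U' := hU.preimage continuous_torusCover
  have hVo : IsOpen V' := hV.preimage continuous_torusCover
  have hUV' : Disjoint U' V' := hUV.preimage _
  have hcov' : ∀ z, z ∈ U' ∪ V' ∪ torusCover ⁻¹' K := fun z => by
    have : torusCover z ∈ U ∪ V ∪ K := hcov ▸ Set.mem_univ _
    exact this
  have hdense : (Set.univ : Set ℂ) ⊆ closure U' ∪ closure V' := by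
    intro z _
    by_contra hz
    have hnhds : (closure U' ∪ closure V')ᶜ ∩ Metric.ball z (1 / 4) ∈ nhds z :=
      Filter.inter_mem ((isClosed_closure.union isClosed_closure).isOpen_compl.mem_nhds hz)
        (Metric.ball_mem_nhds z (by norm_num))
    obtain ⟨δ, hδ, hball⟩ := Metric.mem_nhds_iff.1 hnhds
    have hsub := htd' z (Metric.ball z δ) (fun w hw => by
      refine ⟨((hcov' w).resolve_left fun h => (hball hw).1 ?_), (hball hw).2⟩
      exact h.imp (fun h => subset_closure h) (fun h => subset_closure h))
      (convex_ball z δ).isPreconnected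
    have heq : z = z + (δ / 2 : ℝ) := hsub (Metric.mem_ball_self hδ) (by
      rw [Metric.mem_ball, dist_eq_norm, add_sub_cancel_left, Complex.norm_real,
        Real.norm_of_nonneg (by positivity)]
      linarith)
    have : ((δ / 2 : ℝ) : ℂ) = 0 := by simpa using heq
    have : δ / 2 = 0 := by exact_mod_cast this
    linarith
  obtain ⟨x, -, hxU, hxV⟩ := isPreconnected_closed_iff.1 (isPreconnected_univ (α := ℂ))
    _ _ isClosed_closure isClosed_closure hdense
    (by simpa using (hUne.preimage torusCover_surjective).closure)
    (by simpa using (hVne.preimage torusCover_surjective).closure)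
  obtain ⟨q, hq, hqV⟩ := mem_closure_iff_nhds.1 hxV _
    (Metric.ball_mem_nhds x (by norm_num : (0 : ℝ) < 1 / 4))
  have hqx : 0 < dist q x := dist_pos.2 fun h =>
    Set.disjoint_left.1 (hUV'.closure_left hVo) hxU (h ▸ hqV)
  obtain ⟨p, hp, hpU⟩ := mem_closure_iff_nhds.1 hxU _ (Metric.ball_mem_nhds x hqx)
  refine Complex.not_isTotallyDisconnected_of_separates hUo hVo
    (hK.preimage continuous_torusCover) hUV' (hUK.preimage _) (fun z _ => hcov' z) hpU
    (by simpa [dist_eq_norm] using hp) hqV (dist_eq_norm q x).symm fun t ht hpre =>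
      htd' x t (ht.trans (Set.inter_subset_inter_right _ ?_)) hpre
  exact Metric.closedBall_subset_ball hq

theorem IsMarkovPartition.not_isTotallyDisconnected_boundary
    {f : UnitAddTorus (Fin 2) → UnitAddTorus (Fin 2)} {n : ℕ}
    {R : Fin n → Set (UnitAddTorus (Fin 2))} (hR : IsMarkovPartition f R) :
    ¬ IsTotallyDisconnected (partitionBoundary R) := by
  have : Nontrivial (UnitAddTorus (Fin 2)) := by
    refine ⟨torusCover 0, torusCover (1 / 8), fun h => ?_⟩
    have := injOn_torusCover 0 (by simp) (by simp; norm_num) h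
    norm_num at this
  obtain ⟨i, j, hij⟩ := hR.exists_ne
  refine not_isTotallyDisconnected_of_separates_torus (U := interior (R i))
    (V := ⋃ k ∈ {k | k ≠ i}, interior (R k)) isOpen_interior
    (isOpen_biUnion fun _ _ => isOpen_interior) (isClosed_iUnion_of_finite fun _ => isClosed_frontier)
    (Set.disjoint_iUnion₂_right.2 fun k hk => hR.disjoint_interior i k (Ne.symm hk))
    (hR.disjoint_interior_boundary i) (Set.eq_univ_of_forall fun x => ?_)
    (hR.proper i).interior_nonempty ?_
  · by_contra hx
    obtain ⟨k, hk⟩ := hR.exists_mem_interior fun h => hx (Or.inr h)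
    rcases eq_or_ne k i with rfl | hki
    · exact hx (Or.inl (Or.inl hk))
    · exact hx (Or.inl (Or.inr (Set.mem_biUnion (show k ∈ {k | k ≠ i} from hki) hk)))
  · exact (hR.proper j).interior_nonempty.mono
      (Set.subset_biUnion_of_mem (u := fun k => interior (R k)) (Ne.symm hij))

/-- `Dynamics.coverEntropy f F` is the topological entropy of the restriction of `f` to `F`. -/
theorem mainTheorem6 (A : Matrix (Fin 2) (Fin 2) ℤ) (hA : A.IsExpanding) (n : ℕ)
    (R : Fin n → Set (UnitAddTorus (Fin 2))) (hR : IsMarkovPartition (toralEndomorphism A) R) :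
    Set.MapsTo (toralEndomorphism A) (partitionBoundary R) (partitionBoundary R) ∧
    0 < Dynamics.coverEntropy (toralEndomorphism A) (partitionBoundary R) ∧
    ∀ lam : ℝ, IsExpansionConstant (toralEndomorphism A) lam →
      (Real.log lam : EReal) ≤
        Dynamics.coverEntropy (toralEndomorphism A) (partitionBoundary R) := by
  obtain ⟨C, hCF, hC, hnt⟩ : ∃ C ⊆ partitionBoundary R, IsPreconnected C ∧ C.Nontrivial := by
    by_contra! h
    exact hR.not_isTotallyDisconnected_boundary fun C hCF hC => h C hCF hC
  have hent : ∀ lam : ℝ, IsExpansionConstant (toralEndomorphism A) lam →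
      (Real.log lam : EReal) ≤
        Dynamics.coverEntropy (toralEndomorphism A) (partitionBoundary R) :=
    fun lam h => h.log_le_coverEntropy hC hCF hnt
  obtain ⟨lam, hlam⟩ := hA.exists_isExpansionConstant
  refine ⟨hR.mapsTo_boundary (continuous_toralEndomorphism A) hlam.exists_injOn_nhds,
    lt_of_lt_of_le ?_ (hent lam hlam), hent⟩
  exact_mod_cast Real.log_pos hlam.1
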